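/- \textbf{Setting.} Let $n\ge 1$ and $q\ge 2$ be integers, let $\|\cdot\|$ be the Euclidean norm, and let $C\subsetneq\mathbb{R}^q$ be a closed convex cone that is solid ($\operatorname{int}C\neq\emptyset$), pointed ($C\cap -C=\{0\}$) and polyhedral. Let $X\subseteq\mathbb{R}^n$ be convex, let $\Gamma\colon X\to\mathbb{R}^q$ be continuous and $C$-convex (that is, $t\,\Gamma(x_1)+(1-t)\Gamma(x_2)-\Gamma(t x_1+(1-t)x_2)\in C$ for $x_1,x_2\in X$, $t\in[0,1]$), and let $\mathcal{X}\subseteq X$ be compact and convex with nonempty interior. Put $\mathcal{P}=\Gamma(\mathcal{X})+C$ and $C^+=\{w\mid w^{\mathsf T}y\ge 0\ \forall y\in C\}$. Write $\mathcal{H}(w,y)=\{z\mid w^{\mathsf T}z\ge w^{\mathsf T}y\}$, let $\operatorname{ext}A$ be the set of extreme points of $A$, let $a^+=\max\{a,0\}$, and let $\delta^H$ be the Hausdorff distance. \textbf{Algorithm (run without stopping criterion).} \begin{itemize} \item Let $w^1,\dots,w^J$ be vectors with $\|w^j\|=1$ that generate the cone $C^+$. For each $j$ let $x^j$ minimize $(w^j)^{\mathsf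 T}\Gamma(x)$ over $x\in\mathcal{X}$. Put $\mathcal{P}^{\mathrm{out}}_0=\bigcap_{j=1}^J\mathcal{H}(w^j,\Gamma(x^j))$ and $\bar w=\sum_j w^j/\|\sum_j w^j\|$. \item Fix $\beta\ge\sup_{x\in\mathcal{X}}\bar w^{\mathsf T}\Gamma(x)$ and $$\gamma>\sup_{x\in\mathcal{X}}\bar w^{\mathsf T}\Gamma(x)+\max_{v\in\operatorname{ext}\mathcal{P}^{\mathrm{out}}_0}(\bar w^{\mathsf T}v-\beta)^+ +\delta^H(\mathcal{P}^{\mathrm{out}}_0,\mathcal{P}).$$ Put $S(\gamma)=\{y\mid\bar w^{\mathsf T}y\le\gamma\}$ and $\bar{\mathcal{P}}^{\mathrm{out}}_0=\mathcal{P}^{\mathrm{out}}_0\cap S(\gamma)$. \item In iteration $k\ge 0$, for each $v\in\operatorname{ext}\bar{\mathcal{P}}^{\mathrm{out}}_k$ (once per vertex $v$, reusing the solutions if $v$ reappears) take an optimal solution $(x^v,z^v)$ of $$\text{minimize }\|z\|\ \text{ subject to }\ v+z-\Gamma(x)\in C,\ \bar w^{\mathsf T}(v+z)\le\gamma,\ x\in\mathcal{X},\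 z\in\mathbb{R}^q,$$ and an optimal solution $(w^v,\lambda^v)$ of its Lagrange dual $$\text{maximize }\inf_{x\in\mathcal{X},\,z\in\mathbb{R}^q}\Big(\|z\|+w^{\mathsf T}(\Gamma(x)-z-v)+\lambda(\bar w^{\mathsf T}(v+z)-\gamma)\Big)\ \text{ subject to }\ w\in C^+,\ \lambda\ge 0.$$ Choose $v^k\in\operatorname{argmax}\{\|z^v\|\mid v\in\operatorname{ext}\bar{\mathcal{P}}^{\mathrm{out}}_k\}$ and set $$\bar{\mathcal{P}}^{\mathrm{out}}_{k+1}=\bar{\mathcal{P}}^{\mathrm{out}}_k\cap\mathcal{H}\big(w^{v^k}-\lambda^{v^k}\bar w,\ v^k+z^{v^k}\big).$$ \end{itemize} \textbf{Theorem.} For every sequence $(\bar{\mathcal{P}}^{\mathrm{out}}_k)_{k\ge 0}$ produced by this algorithm and every $\varepsilon\in(0,1)$ there is an integer $N\ge 1$ such that for all integers $k\ge N$ $$\delta^H\big(\bar{\mathcal{P}}^{\mathrm{out}}_{k-1},\,\mathcal{P}\cap S(\gamma)\big)\le(1+\varepsilon)\,\bar\lambda(\mathcal{P}\cap S(\gamma))\,k^{\frac{2}{1-q}},\qquad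 \bar\lambda(A)=16\,R(A)\left(\frac{q\,\pi_q}{\pi_{q-1}}\right)^{\frac{2}{q-1}},$$ where $R(A)$ is the radius of the smallest ball containing $A$ and $\pi_m$ is the volume of the unit ball of $\mathbb{R}^m$. -/

import Mathlib

open Set MeasureTheory
open scoped Pointwise

namespace OuterApprox

/-- The Euclidean space `ℝ^m` with its `ℓ₂`-norm. -/
abbrev Euc (m : ℕ) : Type := EuclideanSpace ℝ (Fin m)

/-! ### Halfspaces, polyhedra and size constants -/

/-- The halfspace `{z | wᵀ z ≥ wᵀ y}`; the whole space if `w = 0`. -/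
def halfspace {m : ℕ} (w y : Euc m) : Set (Euc m) :=
  {z | inner ℝ w y ≤ inner ℝ w z}

/-- A set is polyhedral if it is the intersection of finitely many closed halfspaces. -/
def IsPolyhedral {m : ℕ} (A : Set (Euc m)) : Prop :=
  ∃ s : Finset (Euc m × ℝ), A = {y | ∀ a ∈ s, a.2 ≤ inner ℝ a.1 y}

/-- `R(A)`: the radius of the smallest ball containing `A`. -/
noncomputable def circumscribedRadius {m : ℕ} (A : Set (Euc m)) : ℝ :=
  sInf {r : ℝ | 0 ≤ r ∧ ∃ c : Euc m, A ⊆ Metric.closedBall c r}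

/-- `π_m`: the volume of the closed unit ball of `ℝ^m`. -/
noncomputable def unitBallVolume (m : ℕ) : ℝ :=
  (volume (Metric.closedBall (0 : Euc m) 1)).toReal

/-- The constant `16 R(A) (q π_q / π_{q-1}) ^ (2 / (q - 1))`, for `A ⊆ ℝ^q` with `q ≥ 2`. -/
noncomputable def lambdaBar {q : ℕ} (A : Set (Euc q)) : ℝ :=
  16 * circumscribedRadius A *
    ((q : ℝ) * unitBallVolume q / unitBallVolume (q - 1)) ^ ((2 : ℝ) / ((q : ℝ) - 1))

/-! ### Convex vector optimization problems -/

/-- A convex vector optimization problem: minimize `obj x` with respect to the order of the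
cone `cone` subject to `x ∈ feas`. A `ProperCone` is a closed convex cone containing `0`. -/
structure CVOP (n q : ℕ) where
  /-- the ordering cone -/
  cone : ProperCone ℝ (Euc q)
  cone_ne_univ : (cone : Set (Euc q)) ≠ univ
  cone_solid : (interior (cone : Set (Euc q))).Nonempty
  cone_pointed : (cone : Set (Euc q)) ∩ -(cone : Set (Euc q)) = {0}
  /-- the convex set on which the objective is defined; values of `obj` outside are irrelevant -/
  dom : Set (Euc n)
  dom_convex : Convex ℝ dom
  /-- the objective function -/
  obj : Euc n → Euc q
  obj_continuousOn : ContinuousOn obj dom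
  obj_coneConvex : ∀ x₁ ∈ dom, ∀ x₂ ∈ dom, ∀ t ∈ Icc (0 : ℝ) 1,
    t • obj x₁ + (1 - t) • obj x₂ - obj (t • x₁ + (1 - t) • x₂) ∈ cone
  /-- the feasible region -/
  feas : Set (Euc n)
  feas_subset : feas ⊆ dom
  feas_compact : IsCompact feas
  feas_convex : Convex ℝ feas
  feas_interior : (interior feas).Nonempty

namespace CVOP

variable {n q : ℕ} (p : CVOP n q)

/-- The upper image: the image of the feasible region plus the ordering cone. -/
def upperImage : Set (Euc q) := p.obj '' p.feas + (p.cone : Set (Euc q))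

/-- The dual cone `{w | ∀ y ∈ cone, wᵀ y ≥ 0}` of the ordering cone. -/
noncomputable def dualCone : ProperCone ℝ (Euc q) :=
  ProperCone.innerDual (p.cone : Set (Euc q))

/-- `x` is an optimal solution of the weighted sum scalarization
`minimize wᵀ obj(x) subject to x ∈ feas`. -/
def IsWeightedSumSol (w : Euc q) (x : Euc n) : Prop :=
  x ∈ p.feas ∧ ∀ x' ∈ p.feas, (inner ℝ w (p.obj x) : ℝ) ≤ inner ℝ w (p.obj x')

/-- Feasibility of `(x, z)` for the norm-minimizing scalarization
`minimize ‖z‖ subject to obj(x) - z - v ≤_C 0, wbarᵀ(v + z) ≤ γ, x ∈ feas, z ∈ ℝ^q`. -/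
def PrimalFeasible (wbar : Euc q) (γ : ℝ) (v : Euc q) (x : Euc n) (z : Euc q) : Prop :=
  x ∈ p.feas ∧ v + z - p.obj x ∈ p.cone ∧ (inner ℝ wbar (v + z) : ℝ) ≤ γ

/-- Optimality of `(x, z)` for the norm-minimizing scalarization. -/
def IsPrimalSol (wbar : Euc q) (γ : ℝ) (v : Euc q) (x : Euc n) (z : Euc q) : Prop :=
  p.PrimalFeasible wbar γ v x z ∧
    ∀ x' z', p.PrimalFeasible wbar γ v x' z' → ‖z‖ ≤ ‖z'‖

/-- The extended-real-valued objective function of the Lagrange dual of the norm-minimizing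
scalarization. -/
noncomputable def dualObj (wbar : Euc q) (γ : ℝ) (v w : Euc q) (l : ℝ) : EReal :=
  ⨅ x ∈ p.feas, ⨅ z : Euc q,
    ((‖z‖ + inner ℝ w (p.obj x - z - v) + l * (inner ℝ wbar (v + z) - γ) : ℝ) : EReal)

/-- Optimality of `(w, l)` for the Lagrange dual
`maximize dualObj(w, l) subject to w ∈ dualCone, l ≥ 0`. -/
def IsDualSol (wbar : Euc q) (γ : ℝ) (v w : Euc q) (l : ℝ) : Prop :=
  w ∈ p.dualCone ∧ 0 ≤ l ∧
    ∀ w' ∈ p.dualCone, ∀ l' : ℝ, 0 ≤ l' →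
      p.dualObj wbar γ v w' l' ≤ p.dualObj wbar γ v w l

/-- The initial polyhedral outer approximation `⋂_j {y | (w^j)ᵀ y ≥ (w^j)ᵀ obj(x^j)}` of the
upper image. -/
def initialOuter {J : ℕ} (w : Fin J → Euc q) (x : Fin J → Euc n) : Set (Euc q) :=
  ⋂ j, halfspace (w j) (p.obj (x j))

end CVOP

/-- The normalized sum of finitely many vectors. -/
noncomputable def normalizedSum {m J : ℕ} (w : Fin J → Euc m) : Euc m :=
  ‖∑ j, w j‖⁻¹ • ∑ j, w j

/-- The halfspace `S(γ) = {y | wbarᵀ y ≤ γ}`. -/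
def sublevel {m : ℕ} (wbar : Euc m) (γ : ℝ) : Set (Euc m) :=
  {y | inner ℝ wbar y ≤ γ}

/-! ### The algorithm -/

/-- A run of the outer approximation algorithm on the problem `p`, with the Euclidean norm in the
scalarizations and without stopping criterion. The fields record the choices that the algorithm
makes and the resulting outer approximations. -/
structure Run {n q : ℕ} (p : CVOP n q) where
  /-- the number of generators of the dual cone -/
  J : ℕ
  /-- the generators of the dual cone -/
  gen : Fin J → Euc q
  gen_norm : ∀ j, ‖gen j‖ = 1
  gen_hull : (PointedCone.hull ℝ (range gen) : Set (Euc q)) = p.dualCone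
  /-- the computed solutions of the weighted sum scalarizations -/
  xinit : Fin J → Euc n
  xinit_sol : ∀ j, p.IsWeightedSumSol (gen j) (xinit j)
  /-- the constant used in the choice of `γ` -/
  β : ℝ
  β_ge : sSup ((fun x => (inner ℝ (normalizedSum gen) (p.obj x) : ℝ)) '' p.feas) ≤ β
  /-- the level of the halfspace `S(γ)` -/
  γ : ℝ
  γ_gt :
    sSup ((fun x => (inner ℝ (normalizedSum gen) (p.obj x) : ℝ)) '' p.feas)
      + sSup ((fun v => max ((inner ℝ (normalizedSum gen) v : ℝ) - β) 0) ''
          extremePoints ℝ (p.initialOuter gen xinit))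
      + Metric.hausdorffDist (p.initialOuter gen xinit) p.upperImage < γ
  /-- the outer approximations -/
  outer : ℕ → Set (Euc q)
  outer_zero : outer 0 = p.initialOuter gen xinit ∩ sublevel (normalizedSum gen) γ
  /-- the computed solution `(xsol v, zsol v)` of the scalarization at a vertex `v` -/
  xsol : Euc q → Euc n
  zsol : Euc q → Euc q
  primal_sol : ∀ k, ∀ v ∈ extremePoints ℝ (outer k),
    p.IsPrimalSol (normalizedSum gen) γ v (xsol v) (zsol v)
  /-- the computed solution `(wsol v, lsol v)` of the dual problem at a vertex `v` -/
  wsol : Euc q → Euc q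
  lsol : Euc q → ℝ
  dual_sol : ∀ k, ∀ v ∈ extremePoints ℝ (outer k),
    p.IsDualSol (normalizedSum gen) γ v (wsol v) (lsol v)
  /-- the selected farthest vertex of the `k`-th outer approximation -/
  vertex : ℕ → Euc q
  vertex_mem : ∀ k, vertex k ∈ extremePoints ℝ (outer k)
  vertex_max : ∀ k, ∀ v ∈ extremePoints ℝ (outer k), ‖zsol v‖ ≤ ‖zsol (vertex k)‖
  outer_succ : ∀ k, outer (k + 1) = outer k ∩
    halfspace (wsol (vertex k) - lsol (vertex k) • normalizedSum gen)
      (vertex k + zsol (vertex k))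

/-- The compact part `P ∩ S(γ)` of the upper image that a run approximates. -/
def Run.target {n q : ℕ} {p : CVOP n q} (r : Run p) : Set (Euc q) :=
  p.upperImage ∩ sublevel (normalizedSum r.gen) r.γ

end OuterApprox

namespace OuterApprox

/-! Let `A` be the target and `d k` the distance from the selected vertex to `A`, `p k` its
projection and `u k` the outer unit normal there, so that the vertex is `p k + d k • u k`. Strong
duality (`IsDualSol.supports`) shows that, when `d k > 0`, the dual solution is `-u k` in disguise:
each cut is the halfspace supporting `A` at `p k`. Distance to a convex set is controlled by the
extreme points (`hausdorffDist_le_of_extremePoints`), so `d k` bounds the Hausdorff distance.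

The rate is a packing argument. Push each `p i` along `u i` to a sphere of radius `2R` around a ball
of radius `R` containing `A`. A later vertex lies beyond no earlier cut, and this forces the pushed
points with indices up to `k` to be at distance at least `√(2 R d k)` from each other
(`two_mul_le_dist_sq`). Comparing volumes of disjoint balls with that of a shell bounds their
number, hence `d k` is of order `k ^ (-2 / (q - 1))` with leading constant `8 R (2q) ^ (2 / (q -
1))`; `two_mul_rpow_le` compares this with the stated constant. -/

/-! ### Packing balls into a spherical shell -/

theorem pow_sub_pow_le_mul {a b : ℝ} (hb : 0 ≤ b) (hab : b ≤ a) (n : ℕ) :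
    a ^ n - b ^ n ≤ n * (a - b) * a ^ (n - 1) := by
  have ha : 0 ≤ a := hb.trans hab
  induction n with
  | zero => simp
  | succ n ih =>
    rcases n with _ | n
    · simp
    · simp only [Nat.add_sub_cancel] at ih ⊢
      have h1 : a * (a ^ (n + 1) - b ^ (n + 1)) ≤ a * (((n + 1 : ℕ) : ℝ) * (a - b) * a ^ n) :=
        mul_le_mul_of_nonneg_left ih ha
      have h2 : b ^ (n + 1) * (a - b) ≤ a ^ (n + 1) * (a - b) :=
        mul_le_mul_of_nonneg_right (pow_le_pow_left₀ hb hab _) (sub_nonneg.2 hab)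
      calc a ^ (n + 1 + 1) - b ^ (n + 1 + 1)
          = a * (a ^ (n + 1) - b ^ (n + 1)) + b ^ (n + 1) * (a - b) := by ring
        _ ≤ a * (((n + 1 : ℕ) : ℝ) * (a - b) * a ^ n) + a ^ (n + 1) * (a - b) := add_le_add h1 h2
        _ = ((n + 1 + 1 : ℕ) : ℝ) * (a - b) * a ^ (n + 1) := by push_cast; ring

/-- Packing bound: disjoint balls of radius `h` centred on a sphere of radius `ρ` lie in a shell. -/
theorem card_mul_pow_le_of_separated {q : ℕ} (hq : 1 ≤ q) {ι : Type*} (s : Finset ι)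
    (t : ι → Euc q) (c : Euc q) {ρ h : ℝ} (hh : 0 < h) (hρ : h ≤ ρ)
    (ht : ∀ i ∈ s, dist (t i) c = ρ)
    (hsep : ∀ i ∈ s, ∀ j ∈ s, i ≠ j → 2 * h ≤ dist (t i) (t j)) :
    (s.card : ℝ) * h ^ q ≤ (ρ + h) ^ q - (ρ - h) ^ q := by
  have : Nonempty (Fin q) := ⟨⟨0, hq⟩⟩
  set V : ℝ := volume.real (Metric.ball (0 : Euc q) 1) with hV
  have hVpos : 0 < V := by
    rw [hV, Measure.real, ENNReal.toReal_pos_iff]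
    exact ⟨Metric.measure_ball_pos _ _ one_pos, measure_ball_lt_top⟩
  have hball : ∀ (x : Euc q) (r : ℝ), 0 ≤ r → volume.real (Metric.ball x r) = r ^ q * V := by
    intro x r hr
    rw [hV, Measure.real, Measure.addHaar_ball _ _ hr, ENNReal.toReal_mul,
      ENNReal.toReal_ofReal (by positivity)]
    simp [Measure.real]
  have hdisj : (s : Set ι).PairwiseDisjoint fun i => Metric.ball (t i) h := by
    intro i hi j hj hij
    exact Metric.ball_disjoint_ball (by have := hsep i hi j hj hij; linarith)
  have hunion : volume.real (⋃ i ∈ s, Metric.ball (t i) h) = s.card * (h ^ q * V) := by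
    rw [measureReal_biUnion_finset hdisj fun i _ => measurableSet_ball]
    simp [hball _ _ hh.le]
  have hdisj' : Disjoint (⋃ i ∈ s, Metric.ball (t i) h) (Metric.ball c (ρ - h)) := by
    simp only [disjoint_iUnion_left]
    intro i hi
    exact Metric.ball_disjoint_ball (by rw [ht i hi]; linarith)
  have hsub : (⋃ i ∈ s, Metric.ball (t i) h) ∪ Metric.ball c (ρ - h) ⊆ Metric.ball c (ρ + h) := by
    refine union_subset (iUnion₂_subset fun i hi => ?_) (Metric.ball_subset_ball (by linarith))
    exact Metric.ball_subset_ball' (by rw [ht i hi]; linarith)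
  have hle := measureReal_mono hsub (measure_ball_lt_top (μ := volume)).ne
  rw [measureReal_union hdisj' measurableSet_ball
      ((measure_mono (subset_union_left.trans hsub)).trans_lt measure_ball_lt_top).ne, hunion,
    hball _ _ (by linarith), hball _ _ (by linarith)] at hle
  have : (s.card * h ^ q) * V ≤ ((ρ + h) ^ q - (ρ - h) ^ q) * V := by linarith
  exact le_of_mul_le_mul_right this hVpos

/-! ### Ratios of consecutive unit ball volumes -/

theorem unitBallVolume_eq (m : ℕ) (hm : 1 ≤ m) :
    unitBallVolume m = √Real.pi ^ m / Real.Gamma (m / 2 + 1) := by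
  have : Nonempty (Fin m) := ⟨⟨0, hm⟩⟩
  rw [unitBallVolume, EuclideanSpace.volume_closedBall]
  simp only [Fintype.card_fin, ENNReal.ofReal_one, one_pow, one_mul]
  rw [ENNReal.toReal_ofReal]
  have : 0 < Real.Gamma ((m : ℝ) / 2 + 1) := Real.Gamma_pos_of_pos (by positivity)
  positivity

theorem unitBallVolume_pos (m : ℕ) (hm : 1 ≤ m) : 0 < unitBallVolume m := by
  rw [unitBallVolume_eq m hm]
  have : 0 < Real.Gamma ((m : ℝ) / 2 + 1) := Real.Gamma_pos_of_pos (by positivity)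
  positivity

theorem unitBallVolume_add_two (m : ℕ) (hm : 1 ≤ m) :
    unitBallVolume (m + 2) = 2 * Real.pi / (m + 2) * unitBallVolume m := by
  rw [unitBallVolume_eq m hm, unitBallVolume_eq (m + 2) (by omega)]
  have hG : 0 < Real.Gamma ((m : ℝ) / 2 + 1) := Real.Gamma_pos_of_pos (by positivity)
  have h : Real.Gamma (((m + 2 : ℕ) : ℝ) / 2 + 1)
      = ((m : ℝ) / 2 + 1) * Real.Gamma ((m : ℝ) / 2 + 1) := by
    rw [← Real.Gamma_add_one (by positivity)]
    congr 1; push_cast; ring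
  rw [h, pow_add, Real.sq_sqrt Real.pi_pos.le]
  field_simp

theorem unitBallVolume_one : unitBallVolume 1 = 2 := by
  rw [unitBallVolume_eq 1 le_rfl, Real.Gamma_add_one (by norm_num)]
  have : Real.Gamma (((1 : ℕ) : ℝ) / 2) = √Real.pi := by
    rw [Nat.cast_one, Real.Gamma_one_half_eq]
  rw [this]
  have : √Real.pi ≠ 0 := by positivity
  field_simp
  norm_num

theorem unitBallVolume_two : unitBallVolume 2 = Real.pi := by
  rw [unitBallVolume_eq 2 (by norm_num), Real.sq_sqrt Real.pi_pos.le]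
  norm_num [Real.Gamma_two]

/-- Induction in steps of two: under the two-step recursion the ratio of the two sides changes by
`((k + 3) / (k + 2)) ^ 2 ≤ 4`, which the growth of `2 ^ m` absorbs. -/
theorem four_mul_unitBallVolume_sq_le (m : ℕ) (hm : 1 ≤ m) :
    4 * unitBallVolume m ^ 2 ≤ 2 ^ m * unitBallVolume (m + 1) ^ 2 := by
  induction m using Nat.strong_induction_on with
  | _ m ih =>
    obtain rfl | rfl | h3 : m = 1 ∨ m = 2 ∨ 3 ≤ m := by omega
    · rw [unitBallVolume_one, unitBallVolume_two]
      nlinarith [Real.pi_gt_three]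
    · rw [unitBallVolume_add_two 1 le_rfl, unitBallVolume_one, unitBallVolume_two]
      nlinarith [sq_nonneg Real.pi]
    · obtain ⟨k, rfl⟩ : ∃ k, m = k + 2 := ⟨m - 2, by omega⟩
      have := ih k (by omega) (by omega)
      rw [show k + 2 + 1 = (k + 1) + 2 by ring, unitBallVolume_add_two k (by omega),
        unitBallVolume_add_two (k + 1) (by omega), mul_pow, mul_pow]
      have hc : (2 * Real.pi / ((k : ℝ) + 2)) ^ 2
          ≤ 4 * (2 * Real.pi / (((k + 1 : ℕ) : ℝ) + 2)) ^ 2 := by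
        have h0 : (2 * Real.pi / ((k : ℝ) + 2)) ≤ 2 * (2 * Real.pi / (((k + 1 : ℕ) : ℝ) + 2)) := by
          have hp := Real.pi_pos
          push_cast
          rw [← mul_div_assoc, div_le_div_iff₀ (by positivity) (by positivity)]
          have : (0 : ℝ) ≤ k := by positivity
          nlinarith [mul_nonneg hp.le this]
        have := pow_le_pow_left₀ (by positivity) h0 2
        linarith [mul_pow 2 (2 * Real.pi / (((k + 1 : ℕ) : ℝ) + 2)) 2]
      calc 4 * ((2 * Real.pi / ((k : ℝ) + 2)) ^ 2 * unitBallVolume k ^ 2)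
          = (2 * Real.pi / ((k : ℝ) + 2)) ^ 2 * (4 * unitBallVolume k ^ 2) := by ring
        _ ≤ (4 * (2 * Real.pi / (((k + 1 : ℕ) : ℝ) + 2)) ^ 2) *
            (2 ^ k * unitBallVolume (k + 1) ^ 2) := by
          apply mul_le_mul hc this (by positivity) (by positivity)
        _ = _ := by ring

/-- The packing constant obtained from shell volumes is controlled by the ratio of ball volumes. -/
theorem two_mul_rpow_le (q : ℕ) (hq : 2 ≤ q) :
    (2 * q : ℝ) ^ ((2 : ℝ) / ((q : ℝ) - 1)) ≤
      2 * ((q : ℝ) * unitBallVolume q / unitBallVolume (q - 1)) ^ ((2 : ℝ) / ((q : ℝ) - 1)) := by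
  obtain ⟨m, rfl⟩ : ∃ m, q = m + 1 := ⟨q - 1, by omega⟩
  have hm : 1 ≤ m := by omega
  have hm0 : (0 : ℝ) < m := by exact_mod_cast hm
  have hV := unitBallVolume_pos m hm
  have hV' := unitBallVolume_pos (m + 1) (by omega)
  have e : ((m + 1 : ℕ) : ℝ) - 1 = m := by push_cast; ring
  rw [e, Nat.add_sub_cancel]
  set Q : ℝ := ((m + 1 : ℕ) : ℝ) with hQ
  have hQ0 : 0 < Q := by positivity
  -- Writing the factor 2 as an `m`-th root turns both sides into powers with exponent `1 / m`, so
  -- it suffices to compare the bases.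
  have h2 : (2 : ℝ) = ((2 : ℝ) ^ m) ^ (1 / (m : ℝ)) := by
    rw [one_div, Real.pow_rpow_inv_natCast (by norm_num) (by omega)]
  have hsq : ∀ x : ℝ, 0 ≤ x → x ^ ((2 : ℝ) / m) = (x ^ 2) ^ (1 / (m : ℝ)) := by
    intro x hx
    rw [← Real.rpow_natCast, ← Real.rpow_mul hx]
    congr 1; push_cast; ring
  rw [hsq _ (by positivity), hsq _ (by positivity)]
  nth_rewrite 2 [h2]
  rw [← Real.mul_rpow (by positivity) (by positivity)]
  apply Real.rpow_le_rpow (by positivity) _ (by positivity)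
  rw [div_pow, ← mul_div_assoc, le_div_iff₀ (by positivity)]
  have := mul_le_mul_of_nonneg_left (four_mul_unitBallVolume_sq_le m hm) (sq_nonneg Q)
  nlinarith

/-! ### Decay of the depths of a cut sequence -/

section CutSequence

/-- Lifting points of a ball along unit directions to a sphere of twice the radius. -/
theorem exists_dist_add_smul_eq {m : ℕ} {c p u : Euc m} {R : ℝ} (hR : 0 < R)
    (hp : dist p c ≤ R) (hu : ‖u‖ = 1) : ∃ τ, R ≤ τ ∧ dist (p + τ • u) c = 2 * R := by
  have hcont : ContinuousOn (fun τ : ℝ => dist (p + τ • u) c) (Icc R (3 * R)) := by fun_prop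
  have h1 : dist (p + R • u) c ≤ 2 * R := by
    calc dist (p + R • u) c ≤ dist (p + R • u) p + dist p c := dist_triangle _ _ _
      _ ≤ R + R := by
        refine add_le_add ?_ hp
        rw [dist_eq_norm, add_sub_cancel_left, norm_smul, hu, Real.norm_of_nonneg hR.le, mul_one]
      _ = 2 * R := by ring
  have h2 : 2 * R ≤ dist (p + (3 * R) • u) c := by
    have h3 : dist (p + (3 * R) • u) p = 3 * R := by
      rw [dist_eq_norm, add_sub_cancel_left, norm_smul, hu, Real.norm_of_nonneg (by linarith),
        mul_one]
    have := dist_triangle (p + (3 * R) • u) c p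
    rw [h3, dist_comm c p] at this
    linarith
  obtain ⟨τ, hτ, h⟩ := intermediate_value_Icc (by linarith) hcont ⟨h1, h2⟩
  exact ⟨τ, hτ.1, h⟩

/-- With `D = p - p'` and `c = ⟪u, u'⟫`, the squared distance is `‖D‖² + (a - b)² + 2a⟪u, D⟫ -
2b⟪u', D⟫ + 2ab(1 - c)`. The cut gives `⟪u, D⟫ ≥ d c` and the projection gives `⟪u', D⟫ ≤ 0`,
leaving at least `2ad + 2a(b - d)(1 - c) ≥ 2Rd`. -/
theorem two_mul_le_dist_sq {m : ℕ} {p p' u u' : Euc m} {R d a b : ℝ}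
    (hu : ‖u‖ = 1) (hu' : ‖u'‖ = 1) (hd : 0 ≤ d) (hdR : d ≤ R) (ha : R ≤ a) (hb : R ≤ b)
    (hcut : inner ℝ u (p' + d • u' - p) ≤ 0) (hproj : inner ℝ u' (p - p') ≤ 0) :
    2 * R * d ≤ dist (p + a • u) (p' + b • u') ^ 2 := by
  have hc : inner ℝ u u' ≤ (1 : ℝ) := by
    simpa [hu, hu'] using real_inner_le_norm u u'
  rw [dist_eq_norm, show p + a • u - (p' + b • u') = (p - p') + (a • u - b • u') by abel]
  rw [show p' + d • u' - p = d • u' - (p - p') by abel, inner_sub_right,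
    real_inner_smul_right] at hcut
  generalize p - p' = D at hcut hproj ⊢
  rw [norm_add_sq_real, norm_sub_sq_real]
  simp only [inner_sub_right, real_inner_smul_right, real_inner_smul_left, norm_smul, hu, hu',
    Real.norm_eq_abs, mul_one, sq_abs]
  rw [real_inner_comm u D, real_inner_comm u' D]
  set c : ℝ := inner ℝ u u'
  have hR : 0 ≤ R := hd.trans hdR
  have h1 : 0 ≤ a * (inner ℝ u D - d * c) := mul_nonneg (hR.trans ha) (by linarith)
  have h2 : 0 ≤ b * (-inner ℝ u' D) := mul_nonneg (hR.trans hb) (by linarith)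
  have h3 : 0 ≤ a * ((b - d) * (1 - c)) :=
    mul_nonneg (hR.trans ha) (mul_nonneg (by linarith) (by linarith))
  have h4 : 0 ≤ (a - R) * d := mul_nonneg (by linarith) hd
  nlinarith [sq_nonneg ‖D‖, sq_nonneg (a - b)]

/-- A sequence of cuts of a set at points `p k` with outer unit normals `u k` and depths `d k`. -/
structure IsCutSequence {m : ℕ} (p u : ℕ → Euc m) (d : ℕ → ℝ) : Prop where
  nonneg : ∀ k, 0 ≤ d k
  anti : Antitone d
  norm_eq : ∀ k, 0 < d k → ‖u k‖ = 1
  cut : ∀ i j, i < j → 0 < d j → inner ℝ (u i) (p j + d j • u j - p i) ≤ (0 : ℝ)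
  proj : ∀ i j, 0 < d j → inner ℝ (u j) (p i - p j) ≤ (0 : ℝ)

variable {q : ℕ} {p u : ℕ → Euc q} {d : ℕ → ℝ}

theorem IsCutSequence.le_dist (h : IsCutSequence p u d) {i j : ℕ} (hij : i < j) (hj : 0 < d j) :
    d i ≤ dist (p i + d i • u i) (p j + d j • u j) := by
  have hi : 0 < d i := hj.trans_le (h.anti hij.le)
  have h1 := h.cut i j hij hj
  have h2 := real_inner_le_norm (u i) ((p i + d i • u i) - (p j + d j • u j))
  rw [h.norm_eq i hi, one_mul, ← dist_eq_norm] at h2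
  rw [show (p i + d i • u i) - (p j + d j • u j) = d i • u i - (p j + d j • u j - p i) by abel,
    inner_sub_right, real_inner_smul_right, real_inner_self_eq_norm_sq, h.norm_eq i hi] at h2
  linarith

/-- Depths bounded below by `δ` would make the tips `p k + d k • u k` a `δ`-separated sequence in a
bounded set, contradicting Bolzano–Weierstrass. -/
theorem IsCutSequence.tendsto_zero (h : IsCutSequence p u d) {K : Set (Euc q)}
    (hK : Bornology.IsBounded K) (hpK : ∀ k, p k + d k • u k ∈ K) :
    Filter.Tendsto d Filter.atTop (nhds 0) := by
  rw [Metric.tendsto_atTop]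
  intro δ hδ
  by_contra hcon
  have hall : ∀ k, δ ≤ d k := by
    intro k
    by_contra hk
    refine hcon ⟨k, fun n hn => ?_⟩
    rw [Real.dist_eq, sub_zero, abs_of_nonneg (h.nonneg n)]
    exact (h.anti hn).trans_lt (not_le.1 hk)
  obtain ⟨a, -, φ, hφ, hlim⟩ := tendsto_subseq_of_bounded hK hpK
  obtain ⟨N, hN⟩ := Metric.cauchySeq_iff.1 hlim.cauchySeq δ hδ
  have h1 := hN N le_rfl (N + 1) (Nat.le_succ N)
  have h2 := h.le_dist (hφ (Nat.lt_succ_self N)) (hδ.trans_le (hall _))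
  exact absurd ((hall _).trans h2) (not_le.2 h1)

/-- The points with indices in `[M, k]`, lifted to the sphere of radius `2R`, carry disjoint balls.
Starting at `M` guarantees the condition `d j ≤ R` of the separation estimate. The shell volume is
linear in its thickness, so one factor of the ball radius cancels. -/
theorem IsCutSequence.card_mul_pow_le (hq : 1 ≤ q) (h : IsCutSequence p u d) {c : Euc q} {R : ℝ}
    (hR : 0 < R) (hp : ∀ k, dist (p k) c ≤ R) {M k : ℕ} (hM : d M ≤ R) (hk : 0 < d k) :
    ((k + 1 - M : ℕ) : ℝ) * √(R * d k / 2) ^ (q - 1)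
      ≤ 2 * q * (2 * R + √(R * d k / 2)) ^ (q - 1) := by
  rcases lt_or_ge k M with hkM | hMk
  · rw [Nat.sub_eq_zero_of_le hkM]
    simp only [Nat.cast_zero, zero_mul]
    positivity
  -- Chosen so that `(2e)² = 2 R d k`, the separation available for all indices in the range.
  set e := √(R * d k / 2) with he
  have hepos : 0 < e := by positivity
  have hesq : e ^ 2 = R * d k / 2 := Real.sq_sqrt (by positivity)
  have hdk : d k ≤ R := (h.anti hMk).trans hM
  have heR : e ≤ 2 * R := by
    apply le_of_sq_le_sq _ (by positivity)
    rw [hesq]; nlinarith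
  have hτ : ∀ i, ∃ τ, i ≤ k → R ≤ τ ∧ dist (p i + τ • u i) c = 2 * R := by
    intro i
    by_cases hi : i ≤ k
    · obtain ⟨τ, h'⟩ := exists_dist_add_smul_eq hR (hp i) (h.norm_eq i (hk.trans_le (h.anti hi)))
      exact ⟨τ, fun _ => h'⟩
    · exact ⟨0, fun h' => absurd h' hi⟩
  choose τ hτ using hτ
  have hlt : ∀ i ∈ Finset.Icc M k, ∀ j ∈ Finset.Icc M k, i < j →
      2 * e ≤ dist (p i + τ i • u i) (p j + τ j • u j) := by
    intro i hi j hj hij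
    rw [Finset.mem_Icc] at hi hj
    have hdj : 0 < d j := hk.trans_le (h.anti hj.2)
    have := two_mul_le_dist_sq (h.norm_eq i (hk.trans_le (h.anti hi.2))) (h.norm_eq j hdj)
      hdj.le ((h.anti hj.1).trans hM) (hτ i hi.2).1 (hτ j hj.2).1 (h.cut i j hij hdj)
      (h.proj i j hdj)
    apply le_of_sq_le_sq _ dist_nonneg
    rw [mul_pow, hesq]
    nlinarith [h.anti hj.2]
  have hpack := card_mul_pow_le_of_separated hq (Finset.Icc M k) (fun i => p i + τ i • u i) c
    hepos heR (fun i hi => (hτ i (Finset.mem_Icc.1 hi).2).2) (by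
      intro i hi j hj hij
      rcases lt_or_gt_of_ne hij with hlt' | hlt'
      · exact hlt i hi j hj hlt'
      · rw [dist_comm]; exact hlt j hj i hi hlt')
  have hpow := pow_sub_pow_le_mul (a := 2 * R + e) (b := 2 * R - e) (by linarith) (by linarith) q
  rw [Nat.card_Icc] at hpack
  have hqq : e ^ q = e ^ (q - 1) * e := by rw [← pow_succ, Nat.sub_add_cancel hq]
  rw [hqq] at hpack
  have h5 : (((k + 1 - M : ℕ) : ℝ) * e ^ (q - 1)) * e
      ≤ (2 * q * (2 * R + e) ^ (q - 1)) * e := by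
    calc _ = ((k + 1 - M : ℕ) : ℝ) * (e ^ (q - 1) * e) := by ring
      _ ≤ _ := hpack.trans hpow
      _ = _ := by ring
  exact le_of_mul_le_mul_right h5 hepos

theorem le_mul_rpow_of_mul_pow_le {n : ℕ} (hn : 1 ≤ n) {N x y K : ℝ} (hN : 0 < N) (hx : 0 ≤ x)
    (hy : 0 ≤ y) (hK : 0 ≤ K) (h : N * x ^ n ≤ K * y ^ n) :
    x ^ 2 ≤ y ^ 2 * (K / N) ^ ((2 : ℝ) / n) := by
  have h1 : x ^ n ≤ (K / N) * y ^ n := by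
    rw [div_mul_eq_mul_div, le_div_iff₀ hN]; linarith
  have hroot : ∀ t : ℝ, 0 ≤ t → (t ^ n) ^ ((2 : ℝ) / n) = t ^ 2 := by
    intro t ht
    rw [← Real.rpow_natCast, ← Real.rpow_mul ht, mul_div_cancel₀ _ (by positivity)]
    exact Real.rpow_natCast t 2
  have h2 := Real.rpow_le_rpow (by positivity) h1 (show 0 ≤ (2 : ℝ) / n by positivity)
  rw [Real.mul_rpow (by positivity) (by positivity), hroot x hx, hroot y hy] at h2
  linarith

/-- The depths of a sequence of cuts decay at the rate `k ^ (-2 / (q - 1))`. -/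
theorem IsCutSequence.exists_rate (hq : 2 ≤ q) (h : IsCutSequence p u d) {R : ℝ} (hR : 0 < R)
    (hlim : Filter.Tendsto d Filter.atTop (nhds 0))
    (hp : ∀ R' > R, ∃ c, ∀ k, dist (p k) c ≤ R') {ε : ℝ} (hε : ε ∈ Ioo (0 : ℝ) 1) :
    ∃ N : ℕ, 1 ≤ N ∧ ∀ k : ℕ, N ≤ k → d (k - 1) ≤
      (1 + ε) * (8 * R * (2 * q : ℝ) ^ ((2 : ℝ) / ((q : ℝ) - 1))) *
        (k : ℝ) ^ ((2 : ℝ) / (1 - (q : ℝ))) := by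
  -- Five factors `1 + η` are lost: one in passing from `R` to `R'`, two in `(2R' + e)²`, two in
  -- replacing `k - M` by `k`. For `η ≤ 1`, `(1 + η)^5 ≤ 1 + 31η`.
  set η : ℝ := ε / 31 with hη
  have hη0 : 0 < η := by have := hε.1; positivity
  have hη1 : η ≤ 1 := by have := hε.2; rw [hη]; linarith
  have hη5 : (1 + η) ^ 5 ≤ 1 + ε := by
    have h2 : η ^ 2 ≤ η := by nlinarith
    have h3 : η ^ 3 ≤ η := by nlinarith
    have h4 : η ^ 4 ≤ η := by nlinarith
    have h5 : η ^ 5 ≤ η := by nlinarith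
    have : ε = 31 * η := by rw [hη]; ring
    rw [this]
    nlinarith
  set R' := (1 + η) * R with hR'
  have hR'0 : 0 < R' := by positivity
  obtain ⟨c, hc⟩ := hp R' (by rw [hR']; nlinarith)
  -- The first bound is what the packing estimate needs; the second makes `e ≤ 2R'η`.
  obtain ⟨M, hM⟩ := (hlim.eventually (gt_mem_nhds (show 0 < min R' (8 * R' * η ^ 2) by
    positivity))).exists
  have hM1 : d M ≤ R' := hM.le.trans (min_le_left _ _)
  have hM2 : d M ≤ 8 * R' * η ^ 2 := hM.le.trans (min_le_right _ _)
  -- This threshold yields `k ≤ (1 + η)(k - M)` for `k ≥ N`.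
  obtain ⟨N, hN⟩ := exists_nat_gt ((1 + η) * M / η)
  refine ⟨max N (M + 1), by omega, fun k hk => ?_⟩
  have hkM : M + 1 ≤ k := (le_max_right _ _).trans hk
  have hk0 : (0 : ℝ) < k := by exact_mod_cast (by omega : 0 < k)
  have hkN : (1 + η) * M < k * η := by
    rw [div_lt_iff₀ hη0] at hN
    have : (N : ℝ) ≤ k := by exact_mod_cast (le_max_left _ _).trans hk
    nlinarith
  have hq1 : (0 : ℝ) < (q : ℝ) - 1 := by
    have : (2 : ℝ) ≤ q := by exact_mod_cast hq
    linarith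
  set α : ℝ := (2 : ℝ) / ((q : ℝ) - 1) with hα
  have hα0 : 0 ≤ α := by positivity
  have hα2 : α ≤ 2 := by
    rw [hα, div_le_iff₀ hq1]
    have : (2 : ℝ) ≤ q := by exact_mod_cast hq
    linarith
  have hexp : (2 : ℝ) / (1 - (q : ℝ)) = -α := by
    rw [hα, ← div_neg, neg_sub]
  rw [hexp]
  rcases (h.nonneg (k - 1)).eq_or_lt with h0 | hpos
  · rw [← h0]
    have := hε.1
    positivity
  have hcard := h.card_mul_pow_le (by omega) hR'0 hc hM1 hpos
  set e := √(R' * d (k - 1) / 2) with he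
  have hesq : e ^ 2 = R' * d (k - 1) / 2 := Real.sq_sqrt (by positivity)
  have he0 : 0 ≤ e := Real.sqrt_nonneg _
  have hdk : d (k - 1) ≤ 8 * R' * η ^ 2 := (h.anti (by omega)).trans hM2
  have heη : e ≤ 2 * R' * η := by
    apply le_of_sq_le_sq _ (by positivity)
    rw [hesq]; nlinarith
  -- The depth has index `k - 1`, so the range `[M, k - 1]` supplies `k - M` points.
  rw [show k - 1 + 1 - M = k - M by omega, Nat.cast_sub (by omega)] at hcard
  have hkM' : (0 : ℝ) < (k : ℝ) - M := by
    have : (M : ℝ) + 1 ≤ k := by exact_mod_cast hkM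
    linarith
  have hmain := le_mul_rpow_of_mul_pow_le (by omega) hkM' he0 (by positivity) (by positivity) hcard
  rw [Nat.cast_sub (by omega : 1 ≤ q), Nat.cast_one, ← hα] at hmain
  have hT : (2 * q / ((k : ℝ) - M)) ^ α ≤ (1 + η) ^ 2 * ((2 * q : ℝ) ^ α * (k : ℝ) ^ (-α)) := by
    have h1 : 2 * q / ((k : ℝ) - M) ≤ (1 + η) * (2 * q / k) := by
      rw [← mul_div_assoc, div_le_div_iff₀ hkM' hk0]
      have : (k : ℝ) ≤ (1 + η) * (k - M) := by nlinarith
      nlinarith [mul_le_mul_of_nonneg_left this (show (0 : ℝ) ≤ 2 * q by positivity)]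
    calc _ ≤ ((1 + η) * (2 * q / k)) ^ α := Real.rpow_le_rpow (by positivity) h1 hα0
      _ = (1 + η) ^ α * ((2 * q : ℝ) ^ α * (k : ℝ) ^ (-α)) := by
        rw [Real.mul_rpow (by positivity) (by positivity),
          Real.div_rpow (by positivity) (by positivity), Real.rpow_neg hk0.le, div_eq_mul_inv]
      _ ≤ _ := by
        apply mul_le_mul_of_nonneg_right _ (by positivity)
        rw [← Real.rpow_natCast]
        exact Real.rpow_le_rpow_of_exponent_le (by linarith) (by exact_mod_cast hα2)
  have hY : (2 * R' + e) ^ 2 ≤ 4 * R' ^ 2 * (1 + η) ^ 2 := by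
    have := pow_le_pow_left₀ (by positivity) (add_le_add_right heη (2 * R')) 2
    linarith [this, show (2 * R' + 2 * R' * η) ^ 2 = 4 * R' ^ 2 * (1 + η) ^ 2 by ring]
  set S := (2 * q : ℝ) ^ α * (k : ℝ) ^ (-α) with hS
  have hS0 : 0 ≤ S := by positivity
  have hfin : R' * d (k - 1) ≤ R' * (8 * R' * (1 + η) ^ 4 * S) := by
    have h1 := hmain.trans (mul_le_mul hY hT (by positivity) (by positivity))
    rw [hesq] at h1
    linarith [h1, show 4 * R' ^ 2 * (1 + η) ^ 2 * ((1 + η) ^ 2 * S) * 2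
      = R' * (8 * R' * (1 + η) ^ 4 * S) by ring]
  calc d (k - 1) ≤ 8 * R' * (1 + η) ^ 4 * S := le_of_mul_le_mul_left hfin hR'0
    _ = (1 + η) ^ 5 * (8 * R * S) := by rw [hR']; ring
    _ ≤ (1 + ε) * (8 * R * S) := mul_le_mul_of_nonneg_right hη5 (by positivity)
    _ = _ := by rw [hS]; ring

end CutSequence

/-! ### Halfspaces and Lagrange multipliers -/

theorem convex_halfspace {m : ℕ} (w y : Euc m) : Convex ℝ (halfspace w y) :=
  convex_halfSpace_ge (innerₛₗ ℝ w).isLinear _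

theorem isClosed_halfspace {m : ℕ} (w y : Euc m) : IsClosed (halfspace w y) :=
  isClosed_le continuous_const (by fun_prop)

theorem convex_sublevel {m : ℕ} (w : Euc m) (γ : ℝ) : Convex ℝ (sublevel w γ) :=
  convex_halfSpace_le (innerₛₗ ℝ w).isLinear _

theorem isClosed_sublevel {m : ℕ} (w : Euc m) (γ : ℝ) : IsClosed (sublevel w γ) :=
  isClosed_le (by fun_prop) continuous_const

/-- Lagrange multiplier for minimizing a linear function over a convex set subject to one linear
constraint satisfying Slater's condition. -/
theorem exists_lagrange_multiplier {m : ℕ} {P : Set (Euc m)} (hP : Convex ℝ P) {b ω : Euc m}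
    {γ μ : ℝ} (hS : ∃ y ∈ P, (inner ℝ b y : ℝ) < γ)
    (h : ∀ y ∈ P, (inner ℝ b y : ℝ) ≤ γ → μ ≤ inner ℝ ω y) :
    ∃ l : ℝ, 0 ≤ l ∧ ∀ y ∈ P, μ ≤ inner ℝ ω y + l * (inner ℝ b y - γ) := by
  -- The segment from `y₁` to `y₂` meets the hyperplane `⟪b, y⟫ = γ` in a feasible point; the bound
  -- `μ` there says that lower bounds on the multiplier never exceed upper bounds.
  have key : ∀ y₁ ∈ P, ∀ y₂ ∈ P, γ < inner ℝ b y₁ → (inner ℝ b y₂ : ℝ) < γ →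
      (μ - inner ℝ ω y₁) / (inner ℝ b y₁ - γ) ≤ (inner ℝ ω y₂ - μ) / (γ - inner ℝ b y₂) := by
    intro y₁ h₁ y₂ h₂ hg₁ hg₂
    have hs : (0 : ℝ) < inner ℝ b y₁ - inner ℝ b y₂ := by linarith
    have hmem : ((γ - inner ℝ b y₂) / (inner ℝ b y₁ - inner ℝ b y₂)) • y₁
        + ((inner ℝ b y₁ - γ) / (inner ℝ b y₁ - inner ℝ b y₂)) • y₂ ∈ P :=
      hP h₁ h₂ (div_nonneg (by linarith) hs.le) (div_nonneg (by linarith) hs.le)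
        (by field_simp; ring)
    have := h _ hmem (by
      rw [inner_add_right, real_inner_smul_right, real_inner_smul_right]
      apply le_of_eq
      field_simp
      ring)
    rw [inner_add_right, real_inner_smul_right, real_inner_smul_right, div_mul_eq_mul_div,
      div_mul_eq_mul_div, ← add_div, le_div_iff₀ hs] at this
    rw [div_le_div_iff₀ (by linarith) (by linarith)]
    linarith
  obtain ⟨y₀, hy₀, hg₀⟩ := hS
  -- All lower bounds on the multiplier, including nonnegativity. Slater's point bounds `T` above,
  -- and `sSup T` is the multiplier.
  set T : Set ℝ := insert 0
    ((fun y => (μ - inner ℝ ω y) / (inner ℝ b y - γ)) '' {y | y ∈ P ∧ γ < inner ℝ b y}) with hT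
  have hub : ∀ y ∈ P, (inner ℝ b y : ℝ) < γ →
      (inner ℝ ω y - μ) / (γ - inner ℝ b y) ∈ upperBounds T := by
    rintro y hy hg _ (rfl | ⟨y', ⟨hy', hg'⟩, rfl⟩)
    · exact div_nonneg (sub_nonneg.2 (h y hy hg.le)) (by linarith)
    · exact key y' hy' y hy hg' hg
  have hbdd : BddAbove T := ⟨_, hub y₀ hy₀ hg₀⟩
  refine ⟨sSup T, le_csSup hbdd (mem_insert _ _), fun y hy => ?_⟩
  rcases lt_trichotomy (inner ℝ b y : ℝ) γ with hg | hg | hg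
  · have := csSup_le ⟨0, mem_insert _ _⟩ (hub y hy hg)
    rw [le_div_iff₀ (by linarith)] at this
    linarith
  · have := h y hy hg.le
    rw [hg, sub_self, mul_zero, add_zero]
    exact this
  · have := le_csSup hbdd (mem_insert_of_mem _ ⟨y, ⟨hy, hg⟩, rfl⟩)
    rw [div_le_iff₀ (by linarith)] at this
    linarith

/-- The first hypothesis gives `‖ν‖ ≤ 1`, so the second is the equality case of Cauchy–Schwarz. -/
theorem eq_norm_smul_of_le_inner {m : ℕ} {ν z : Euc m} (h : ∀ ζ, (inner ℝ ν ζ : ℝ) ≤ ‖ζ‖)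
    (hz : ‖z‖ ≤ inner ℝ ν z) : z = ‖z‖ • ν := by
  have hν : ‖ν‖ ≤ 1 := by
    have := h ν
    rw [real_inner_self_eq_norm_sq] at this
    nlinarith [norm_nonneg ν]
  have hsq : ‖z - ‖z‖ • ν‖ ^ 2 ≤ 0 := by
    rw [norm_sub_sq_real, real_inner_smul_right, norm_smul, norm_norm, real_inner_comm]
    have h1 : ‖z‖ * ‖z‖ ≤ ‖z‖ * inner ℝ ν z := mul_le_mul_of_nonneg_left hz (norm_nonneg z)
    have h2 : (‖z‖ * ‖ν‖) ^ 2 ≤ (‖z‖ * 1) ^ 2 :=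
      pow_le_pow_left₀ (by positivity) (mul_le_mul_of_nonneg_left hν (norm_nonneg z)) 2
    nlinarith
  exact sub_eq_zero.1 (norm_eq_zero.1 (pow_eq_zero_iff two_ne_zero |>.1
    (le_antisymm hsq (sq_nonneg _))))

/-! ### Projection and duality for the norm-minimizing scalarization -/

namespace CVOP

variable {n q : ℕ} (p : CVOP n q)

theorem convex_upperImage : Convex ℝ p.upperImage := by
  rintro _ ⟨_, ⟨x₁, hx₁, rfl⟩, c₁, hc₁, rfl⟩ _ ⟨_, ⟨x₂, hx₂, rfl⟩, c₂, hc₂, rfl⟩ a b ha hb hab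
  have hmem := p.obj_coneConvex x₁ (p.feas_subset hx₁) x₂ (p.feas_subset hx₂) a
    ⟨ha, by linarith⟩
  rw [show 1 - a = b by linarith] at hmem
  refine ⟨_, ⟨a • x₁ + b • x₂, p.feas_convex hx₁ hx₂ ha hb hab, rfl⟩,
    (a • p.obj x₁ + b • p.obj x₂ - p.obj (a • x₁ + b • x₂)) + (a • c₁ + b • c₂), ?_, ?_⟩
  · exact add_mem hmem (add_mem (p.cone.smul_mem hc₁ ha) (p.cone.smul_mem hc₂ hb))
  · simp only [smul_add]; abel

theorem mem_dualCone {w : Euc q} : w ∈ p.dualCone ↔ ∀ y ∈ p.cone, (0 : ℝ) ≤ inner ℝ y w := by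
  simp [dualCone, ProperCone.mem_innerDual]

theorem obj_mem_upperImage {x : Euc n} (hx : x ∈ p.feas) : p.obj x ∈ p.upperImage :=
  ⟨_, ⟨x, hx, rfl⟩, 0, p.cone.zero_mem, add_zero _⟩

theorem feas_nonempty : p.feas.Nonempty := p.feas_interior.mono interior_subset

variable {p} {b v z w : Euc q} {γ l : ℝ} {x : Euc n}

theorem exists_primalFeasible_iff :
    (∃ x, p.PrimalFeasible b γ v x z) ↔ v + z ∈ p.upperImage ∩ sublevel b γ := by
  constructor
  · rintro ⟨x, hx, hc, hγ⟩
    exact ⟨⟨_, ⟨x, hx, rfl⟩, _, hc, by simp⟩, hγ⟩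
  · rintro ⟨⟨_, ⟨x, hx, rfl⟩, c, hc, h⟩, hγ⟩
    refine ⟨x, hx, ?_, hγ⟩
    rw [← h]
    simpa using hc

theorem IsPrimalSol.mem (h : p.IsPrimalSol b γ v x z) : v + z ∈ p.upperImage ∩ sublevel b γ :=
  exists_primalFeasible_iff.1 ⟨x, h.1⟩

theorem IsPrimalSol.norm_le (h : p.IsPrimalSol b γ v x z) {y : Euc q}
    (hy : y ∈ p.upperImage ∩ sublevel b γ) : ‖z‖ ≤ ‖v - y‖ := by
  obtain ⟨x', hx'⟩ := (exists_primalFeasible_iff (z := y - v)).2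
    (by rwa [add_sub_cancel])
  rw [norm_sub_rev]
  exact h.2 x' _ hx'

theorem IsPrimalSol.infDist_eq (h : p.IsPrimalSol b γ v x z) :
    Metric.infDist v (p.upperImage ∩ sublevel b γ) = ‖z‖ := by
  apply le_antisymm
  · calc _ ≤ dist v (v + z) := Metric.infDist_le_dist_of_mem h.mem
      _ = ‖z‖ := by simp
  · exact (Metric.le_infDist ⟨_, h.mem⟩).2 fun {y} hy => by
      rw [dist_eq_norm]; exact h.norm_le hy

/-- Variational inequality for the projection `v + z` of `v` onto a convex set. -/
theorem IsPrimalSol.inner_le (h : p.IsPrimalSol b γ v x z) {y : Euc q}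
    (hy : y ∈ p.upperImage ∩ sublevel b γ) : (inner ℝ z (v + z) : ℝ) ≤ inner ℝ z y := by
  have hconv : Convex ℝ (p.upperImage ∩ sublevel b γ) :=
    p.convex_upperImage.inter (convex_sublevel _ _)
  have : Nonempty ↥(p.upperImage ∩ sublevel b γ) := ⟨⟨_, h.mem⟩⟩
  have hmin : ‖v - (v + z)‖ = ⨅ y : ↥(p.upperImage ∩ sublevel b γ), ‖v - y‖ := by
    apply le_antisymm
    · refine le_ciInf fun y => ?_
      simpa using h.norm_le y.2
    · exact ciInf_le ⟨0, by rintro _ ⟨y, rfl⟩; exact norm_nonneg _⟩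
        (⟨_, h.mem⟩ : ↥(p.upperImage ∩ sublevel b γ))
  have := (norm_eq_iInf_iff_real_inner_le_zero hconv h.mem).1 hmin y hy
  rw [show v - (v + z) = -z by abel, inner_neg_left, inner_sub_right] at this
  linarith

theorem le_dualObj_iff {a : ℝ} : (a : EReal) ≤ p.dualObj b γ v w l ↔ ∀ x ∈ p.feas, ∀ ζ : Euc q,
    a ≤ ‖ζ‖ + inner ℝ w (p.obj x - ζ - v) + l * (inner ℝ b (v + ζ) - γ) := by
  simp only [dualObj, le_iInf_iff, EReal.coe_le_coe_iff]

/-- Strong duality for the norm-minimizing scalarization. -/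
theorem IsPrimalSol.exists_le_dualObj (h : p.IsPrimalSol b γ v x z)
    (hS : ∃ x ∈ p.feas, (inner ℝ b (p.obj x) : ℝ) < γ) :
    ∃ w ∈ p.dualCone, ∃ l : ℝ, 0 ≤ l ∧ (‖z‖ : EReal) ≤ p.dualObj b γ v w l := by
  rcases eq_or_ne z 0 with rfl | hz
  · refine ⟨0, p.dualCone.zero_mem, 0, le_rfl, le_dualObj_iff.2 fun x _ ζ => ?_⟩
    simp
  obtain ⟨x₀, hx₀, hγ₀⟩ := hS
  have hz0 : 0 < ‖z‖ := norm_pos_iff.2 hz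
  obtain ⟨l, hl, hL⟩ := exists_lagrange_multiplier p.convex_upperImage (b := b) (γ := γ)
    (ω := ‖z‖⁻¹ • z) (μ := inner ℝ (‖z‖⁻¹ • z) (v + z)) ⟨_, p.obj_mem_upperImage hx₀, hγ₀⟩ (by
      intro y hy hyγ
      rw [real_inner_smul_left, real_inner_smul_left]
      exact mul_le_mul_of_nonneg_left (h.inner_le ⟨hy, hyγ⟩) (by positivity))
  have hω : ‖‖z‖⁻¹ • z‖ = 1 := by
    rw [norm_smul, norm_inv, norm_norm, inv_mul_cancel₀ hz0.ne']
  have hωz : inner ℝ (‖z‖⁻¹ • z) z = ‖z‖ := by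
    rw [real_inner_smul_left, real_inner_self_eq_norm_sq]
    field_simp
  set ω := ‖z‖⁻¹ • z
  -- The multiplier bound holds on all of `obj x₀ + C`; a cone direction on which `ω + l • b` is
  -- negative would make its left side unbounded below, so this vector lies in the dual cone.
  refine ⟨ω + l • b, p.mem_dualCone.2 fun c hc => ?_, l, hl, le_dualObj_iff.2 fun x hx ζ => ?_⟩
  · rw [real_inner_comm]
    by_contra hneg
    rw [not_le] at hneg
    set s : ℝ := inner ℝ (ω + l • b) c with hs
    set a : ℝ := inner ℝ ω (p.obj x₀) + l * (inner ℝ b (p.obj x₀) - γ) - inner ℝ ω (v + z)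
    obtain ⟨N, hN⟩ := exists_nat_gt (a / -s)
    rw [div_lt_iff₀ (by linarith)] at hN
    have := hL (p.obj x₀ + (N : ℝ) • c)
      ⟨_, ⟨x₀, hx₀, rfl⟩, _, p.cone.smul_mem hc (Nat.cast_nonneg N), rfl⟩
    simp only [inner_add_right, real_inner_smul_right] at this
    have hs' : s = inner ℝ ω c + l * inner ℝ b c := by
      rw [hs, inner_add_left, real_inner_smul_left b c l]
    rw [hs'] at hN
    simp only [a, inner_add_right] at hN
    linarith
  · have h1 := hL _ (p.obj_mem_upperImage hx)
    have h2 := real_inner_le_norm ω ζ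
    rw [hω, one_mul] at h2
    simp only [inner_add_left, inner_add_right, inner_sub_right, real_inner_smul_left, hωz] at h1 ⊢
    linarith

/-- At optimal solutions, the dual solution is the unit vector in the direction of the primal
solution, and it supports the feasible set. -/
theorem IsDualSol.supports (hd : p.IsDualSol b γ v w l) (h : p.IsPrimalSol b γ v x z)
    (hS : ∃ x ∈ p.feas, (inner ℝ b (p.obj x) : ℝ) < γ) :
    z = ‖z‖ • (w - l • b) ∧
      p.upperImage ∩ sublevel b γ ⊆ halfspace (w - l • b) (v + z) := by
  obtain ⟨hw, hl, hmax⟩ := hd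
  have hval : (‖z‖ : EReal) ≤ p.dualObj b γ v w l := by
    obtain ⟨w', hw', l', hl', h'⟩ := h.exists_le_dualObj hS
    exact h'.trans (hmax w' hw' l' hl')
  rw [le_dualObj_iff] at hval
  -- Otherwise large multiples of `ζ` would drive the Lagrangian to `-∞`, against strong duality.
  have hν : ∀ ζ, (inner ℝ (w - l • b) ζ : ℝ) ≤ ‖ζ‖ := by
    intro ζ
    by_contra hneg
    rw [not_le] at hneg
    obtain ⟨x₀, hx₀⟩ := p.feas_nonempty
    set a : ℝ := inner ℝ w (p.obj x₀ - v) + l * (inner ℝ b v - γ) - ‖z‖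
    obtain ⟨N, hN⟩ := exists_nat_gt (a / (inner ℝ (w - l • b) ζ - ‖ζ‖))
    rw [div_lt_iff₀ (by linarith)] at hN
    have := hval x₀ hx₀ ((N : ℝ) • ζ)
    simp only [a, inner_add_right, inner_sub_right, inner_sub_left, real_inner_smul_left,
      real_inner_smul_right, norm_smul, Real.norm_natCast] at this hN
    linarith
  -- Evaluate the Lagrangian at `ζ = 0`; the cone part of `y` and the level constraint enter with
  -- the right sign because `w ∈ p.dualCone` and `l ≥ 0`.
  have hA : ∀ y ∈ p.upperImage ∩ sublevel b γ,
      ‖z‖ + inner ℝ (w - l • b) v ≤ inner ℝ (w - l • b) y := by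
    rintro y ⟨⟨_, ⟨x', hx', rfl⟩, c, hc, rfl⟩, hyγ⟩
    have h1 := hval x' hx' 0
    have h2 := p.mem_dualCone.1 hw c hc
    rw [real_inner_comm] at h2
    have h3 := mul_le_mul_of_nonneg_left (show (inner ℝ b (p.obj x' + c) : ℝ) ≤ γ from hyγ) hl
    simp only [inner_add_right, inner_sub_right, inner_sub_left, real_inner_smul_left,
      norm_zero, inner_zero_right] at h1 h3 ⊢
    linarith
  have hz : ‖z‖ ≤ inner ℝ (w - l • b) z := by
    have := hA _ h.mem
    rw [inner_add_right] at this
    linarith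
  refine ⟨eq_norm_smul_of_le_inner hν hz, fun y hy => ?_⟩
  have := hA y hy
  have h2 := hν z
  simp only [halfspace, mem_ofPred_eq, inner_add_right]
  linarith

/-- A small step from `c` in direction `-w` stays in the cone, and pairing it with `w` must still be
nonnegative. -/
theorem inner_pos_of_mem_interior {c : Euc q} (hc : c ∈ interior (p.cone : Set (Euc q)))
    (hw : w ∈ p.dualCone) (hw0 : w ≠ 0) : (0 : ℝ) < inner ℝ w c := by
  obtain ⟨δ, hδ, hball⟩ := Metric.mem_nhds_iff.1 (mem_interior_iff_mem_nhds.1 hc)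
  have hn : 0 < ‖w‖ := norm_pos_iff.2 hw0
  have hmem : c - (δ / 2 / ‖w‖) • w ∈ p.cone := hball (by
    rw [Metric.mem_ball, dist_eq_norm, sub_sub_cancel_left, norm_neg, norm_smul, norm_div,
      norm_norm, div_mul_cancel₀ _ hn.ne', Real.norm_of_nonneg (by positivity)]
    linarith)
  have := p.mem_dualCone.1 hw _ hmem
  rw [inner_sub_left, real_inner_smul_left, real_inner_self_eq_norm_sq, real_inner_comm] at this
  have h2 : 0 < δ / 2 / ‖w‖ * ‖w‖ ^ 2 := by positivity
  linarith

end CVOP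

/-! ### Circumscribed radius and Hausdorff distance -/

theorem circumscribedRadius_pos {m : ℕ} {A : Set (Euc m)} (hA : Bornology.IsBounded A)
    (hn : A.Nontrivial) : 0 < circumscribedRadius A := by
  obtain ⟨x, hx, y, hy, hxy⟩ := hn
  have hpos : 0 < dist x y / 2 := half_pos (dist_pos.2 hxy)
  refine hpos.trans_le (le_csInf ?_ ?_)
  · obtain ⟨r, hr⟩ := hA.subset_closedBall (0 : Euc m)
    exact ⟨max r 0, le_max_right _ _, 0,
      hr.trans (Metric.closedBall_subset_closedBall (le_max_left _ _))⟩
  · rintro r ⟨-, c, hc⟩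
    have h1 := Metric.mem_closedBall.1 (hc hx)
    have h2 := Metric.mem_closedBall.1 (hc hy)
    have := dist_triangle_right x y c
    linarith

theorem exists_subset_closedBall_of_circumscribedRadius_lt {m : ℕ} {A : Set (Euc m)}
    (hA : Bornology.IsBounded A) {R : ℝ} (hR : circumscribedRadius A < R) :
    ∃ c, A ⊆ Metric.closedBall c R := by
  have hne : {r : ℝ | 0 ≤ r ∧ ∃ c : Euc m, A ⊆ Metric.closedBall c r}.Nonempty := by
    obtain ⟨r, hr⟩ := hA.subset_closedBall (0 : Euc m)
    exact ⟨max r 0, le_max_right _ _, 0,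
      hr.trans (Metric.closedBall_subset_closedBall (le_max_left _ _))⟩
  obtain ⟨r, ⟨-, c, hc⟩, hr⟩ := exists_lt_of_csInf_lt hne hR
  exact ⟨c, hc.trans (Metric.closedBall_subset_closedBall hr.le)⟩

/-- The closed `δ`-thickening of a convex set is closed and convex, so by Krein–Milman it contains
`P` as soon as it contains the extreme points of `P`. -/
theorem hausdorffDist_le_of_extremePoints {m : ℕ} {P A : Set (Euc m)} {δ : ℝ} (hδ : 0 ≤ δ)
    (hP : IsCompact P) (hPc : Convex ℝ P) (hA : Convex ℝ A) (hne : A.Nonempty) (hAP : A ⊆ P)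
    (h : ∀ v ∈ extremePoints ℝ P, Metric.infDist v A ≤ δ) :
    (∀ x ∈ P, Metric.infDist x A ≤ δ) ∧ Metric.hausdorffDist P A ≤ δ := by
  have hsub : P ⊆ Metric.cthickening δ A := by
    rw [← closure_convexHull_extremePoints hP hPc]
    refine closure_minimal (convexHull_min (fun v hv => ?_) (hA.cthickening δ))
      Metric.isClosed_cthickening
    rw [Metric.mem_cthickening_iff]
    exact (ENNReal.le_ofReal_iff_toReal_le (Metric.infEDist_ne_top hne) hδ).2 (h v hv)
  have hall : ∀ x ∈ P, Metric.infDist x A ≤ δ := fun x hx => by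
    have := hsub hx
    rw [Metric.mem_cthickening_iff] at this
    exact (ENNReal.le_ofReal_iff_toReal_le (Metric.infEDist_ne_top hne) hδ).1 this
  refine ⟨hall, Metric.hausdorffDist_le_of_infDist hδ hall fun x hx => ?_⟩
  rw [Metric.infDist_zero_of_mem (hAP hx)]
  exact hδ

/-! ### Geometry of a run: compactness, supporting cuts, cut sequence -/

namespace Run

variable {n q : ℕ} {p : CVOP n q} (r : Run p)

theorem gen_mem_dualCone (j : Fin r.J) : r.gen j ∈ p.dualCone := by
  have : r.gen j ∈ (PointedCone.hull ℝ (range r.gen) : Set (Euc q)) :=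
    PointedCone.subset_hull (mem_range_self j)
  rw [r.gen_hull] at this
  exact this

/-- By the bidual theorem the cone is the dual of its dual cone, which the vectors `gen j` generate.
-/
theorem mem_cone_of_gen {u : Euc q} (h : ∀ j, (0 : ℝ) ≤ inner ℝ (r.gen j) u) : u ∈ p.cone := by
  rw [← ProperCone.innerDual_innerDual p.cone, ProperCone.mem_innerDual]
  intro w hw
  change w ∈ (p.dualCone : Set (Euc q)) at hw
  rw [← r.gen_hull] at hw
  refine Submodule.span_induction (p := fun w _ => (0 : ℝ) ≤ inner ℝ w u) ?_ ?_ ?_ ?_ hw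
  · rintro _ ⟨j, rfl⟩
    exact h j
  · simp
  · intro a b _ _ ha hb
    rw [inner_add_left]
    exact add_nonneg ha hb
  · intro t a _ ha
    change (0 : ℝ) ≤ inner ℝ ((t : ℝ) • a) u
    rw [real_inner_smul_left]
    exact mul_nonneg t.2 ha

theorem eq_zero_of_gen {u : Euc q} (h : ∀ j, (inner ℝ (r.gen j) u : ℝ) = 0) : u = 0 := by
  have h1 : u ∈ p.cone := r.mem_cone_of_gen fun j => (h j).ge
  have h2 : -u ∈ p.cone := r.mem_cone_of_gen fun j => by rw [inner_neg_right, h j, neg_zero]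
  have : u ∈ (p.cone : Set (Euc q)) ∩ -(p.cone : Set (Euc q)) := ⟨h1, h2⟩
  rw [p.cone_pointed] at this
  exact this

theorem sum_gen_ne_zero (hq : 1 ≤ q) : ∑ j, r.gen j ≠ 0 := by
  have : Nonempty (Fin q) := ⟨⟨0, hq⟩⟩
  have hJ : Nonempty (Fin r.J) := by
    by_contra hJ
    rw [not_nonempty_iff] at hJ
    obtain ⟨u, hu⟩ := exists_ne (0 : Euc q)
    exact hu (r.eq_zero_of_gen fun j => isEmptyElim j)
  obtain ⟨c, hc⟩ := p.cone_solid
  intro h0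
  have hpos : (0 : ℝ) < ∑ j, inner ℝ (r.gen j) c := by
    apply Finset.sum_pos _ Finset.univ_nonempty
    intro j _
    apply CVOP.inner_pos_of_mem_interior hc (r.gen_mem_dualCone j)
    intro hj
    have := r.gen_norm j
    rw [hj, norm_zero] at this
    exact zero_ne_one this
  rw [← sum_inner, h0, inner_zero_left] at hpos
  exact hpos.false

/-- The map `y ↦ (⟪gen j, y⟫)_j` is injective since the cone is pointed, hence antilipschitz. The
initial halfspaces bound each coordinate below, and the sublevel set bounds their sum above, so the
image lies in a box. -/
theorem isBounded_outer_zero (hq : 1 ≤ q) : Bornology.IsBounded (r.outer 0) := by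
  set L : Euc q →ₗ[ℝ] (Fin r.J → ℝ) := LinearMap.pi fun j => innerₛₗ ℝ (r.gen j) with hL
  have hLa : ∀ y j, L y j = inner ℝ (r.gen j) y := fun y j => rfl
  have hinj : Function.Injective L := by
    rw [injective_iff_map_eq_zero]
    intro u hu
    exact r.eq_zero_of_gen fun j => by rw [← hLa, hu, Pi.zero_apply]
  obtain ⟨K, -, hK⟩ := L.injective_iff_antilipschitz.1 hinj
  have hs : 0 < ‖∑ j, r.gen j‖ := norm_pos_iff.2 (r.sum_gen_ne_zero hq)
  set a : Fin r.J → ℝ := fun j => inner ℝ (r.gen j) (p.obj (r.xinit j)) with ha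
  refine (hK.isBounded_preimage (Metric.isBounded_Icc a
    (fun j => ‖∑ j, r.gen j‖ * r.γ - ∑ i ∈ Finset.univ.erase j, a i))).subset ?_
  rw [r.outer_zero]
  rintro y ⟨hy, hyγ⟩
  have hy' : ∀ j, a j ≤ inner ℝ (r.gen j) y := fun j => mem_iInter.1 hy j
  have hsum : ∑ j, inner ℝ (r.gen j) y ≤ ‖∑ j, r.gen j‖ * r.γ := by
    have : (inner ℝ (normalizedSum r.gen) y : ℝ) ≤ r.γ := hyγ
    rw [normalizedSum, real_inner_smul_left, sum_inner, inv_mul_le_iff₀ hs] at this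
    exact this
  refine ⟨fun j => hy' j, fun j => ?_⟩
  rw [hLa]
  rw [← Finset.add_sum_erase _ _ (Finset.mem_univ j)] at hsum
  have := Finset.sum_le_sum fun i (_ : i ∈ Finset.univ.erase j) => hy' i
  linarith

theorem isClosed_outer (k : ℕ) : IsClosed (r.outer k) := by
  induction k with
  | zero =>
    rw [r.outer_zero]
    exact (isClosed_iInter fun j => isClosed_halfspace _ _).inter (isClosed_sublevel _ _)
  | succ k ih => rw [r.outer_succ]; exact ih.inter (isClosed_halfspace _ _)

theorem convex_outer (k : ℕ) : Convex ℝ (r.outer k) := by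
  induction k with
  | zero =>
    rw [r.outer_zero]
    exact (convex_iInter fun j => convex_halfspace _ _).inter (convex_sublevel _ _)
  | succ k ih => rw [r.outer_succ]; exact ih.inter (convex_halfspace _ _)

theorem outer_antitone : Antitone r.outer :=
  antitone_nat_of_succ_le fun k => by rw [r.outer_succ]; exact inter_subset_left

theorem isCompact_outer (hq : 1 ≤ q) (k : ℕ) : IsCompact (r.outer k) :=
  Metric.isCompact_of_isClosed_isBounded (r.isClosed_outer k)
    ((r.isBounded_outer_zero hq).subset (r.outer_antitone (Nat.zero_le k)))

theorem convex_target : Convex ℝ r.target := p.convex_upperImage.inter (convex_sublevel _ _)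

/-- The other two terms in the lower bound for `γ` are nonnegative, so only the first supremum
matters here. -/
theorem inner_obj_lt {x : Euc n} (hx : x ∈ p.feas) :
    (inner ℝ (normalizedSum r.gen) (p.obj x) : ℝ) < r.γ := by
  have hcont : ContinuousOn (fun x => (inner ℝ (normalizedSum r.gen) (p.obj x) : ℝ)) p.feas :=
    continuousOn_const.inner (p.obj_continuousOn.mono p.feas_subset)
  have h1 := le_csSup (p.feas_compact.image_of_continuousOn hcont).bddAbove ⟨x, hx, rfl⟩
  have h2 : 0 ≤ sSup ((fun v => max ((inner ℝ (normalizedSum r.gen) v : ℝ) - r.β) 0) ''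
      extremePoints ℝ (p.initialOuter r.gen r.xinit)) :=
    Real.sSup_nonneg (by rintro _ ⟨v, -, rfl⟩; exact le_max_right _ _)
  have h3 : 0 ≤ Metric.hausdorffDist (p.initialOuter r.gen r.xinit) p.upperImage :=
    Metric.hausdorffDist_nonneg
  have := r.γ_gt
  simp only at h1
  linarith

theorem slater : ∃ x ∈ p.feas, (inner ℝ (normalizedSum r.gen) (p.obj x) : ℝ) < r.γ :=
  p.feas_nonempty.imp fun _ hx => ⟨hx, r.inner_obj_lt hx⟩

/-- Since the level constraint is strict at `obj x`, a short step along an interior direction of the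
cone stays in the target. This makes the circumscribed radius positive. -/
theorem target_nontrivial (hq : 1 ≤ q) : r.target.Nontrivial := by
  have : Nonempty (Fin q) := ⟨⟨0, hq⟩⟩
  obtain ⟨x, hx⟩ := p.feas_nonempty
  obtain ⟨c, hc⟩ := p.cone_solid
  have hlt := r.inner_obj_lt hx
  have hc0 : c ≠ 0 := by
    rintro rfl
    have h1 := r.sum_gen_ne_zero hq
    apply h1
    apply Finset.sum_eq_zero
    intro j _
    by_contra hj
    have := CVOP.inner_pos_of_mem_interior hc (r.gen_mem_dualCone j) hj
    rw [inner_zero_right] at this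
    exact this.false
  have hlim : Filter.Tendsto (fun t : ℝ => (inner ℝ (normalizedSum r.gen) (p.obj x + t • c) : ℝ))
      (nhdsWithin 0 (Ioi 0)) (nhds (inner ℝ (normalizedSum r.gen) (p.obj x + (0 : ℝ) • c))) :=
    (Continuous.tendsto (by fun_prop) 0).mono_left nhdsWithin_le_nhds
  rw [zero_smul, add_zero] at hlim
  obtain ⟨t, ht, ht0⟩ := ((hlim.eventually (gt_mem_nhds hlt)).and self_mem_nhdsWithin).exists
  refine ⟨p.obj x, ⟨p.obj_mem_upperImage hx, hlt.le⟩, p.obj x + t • c,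
    ⟨⟨_, ⟨x, hx, rfl⟩, _, p.cone.smul_mem (interior_subset hc) ht0.le, rfl⟩, ht.le⟩, ?_⟩
  intro h
  exact smul_ne_zero ht0.ne' hc0 (left_eq_add.1 h)

/-- The unit outer normal of the target at the projection of the selected vertex. -/
noncomputable def normal (k : ℕ) : Euc q :=
  -(r.wsol (r.vertex k) - r.lsol (r.vertex k) • normalizedSum r.gen)

/-- The projection of the selected vertex onto the target. -/
noncomputable def foot (k : ℕ) : Euc q := r.vertex k + r.zsol (r.vertex k)

theorem vertex_sol (k : ℕ) : p.IsPrimalSol (normalizedSum r.gen) r.γ (r.vertex k)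
    (r.xsol (r.vertex k)) (r.zsol (r.vertex k)) :=
  r.primal_sol k _ (r.vertex_mem k)

theorem foot_mem (k : ℕ) : r.foot k ∈ r.target := (r.vertex_sol k).mem

theorem foot_add_smul_normal (k : ℕ) :
    r.foot k + ‖r.zsol (r.vertex k)‖ • r.normal k = r.vertex k := by
  have h := ((r.dual_sol k _ (r.vertex_mem k)).supports (r.vertex_sol k) r.slater).1
  rw [normal, foot, smul_neg, ← h, add_neg_cancel_right]

theorem norm_normal {k : ℕ} (hk : 0 < ‖r.zsol (r.vertex k)‖) : ‖r.normal k‖ = 1 := by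
  have h := ((r.dual_sol k _ (r.vertex_mem k)).supports (r.vertex_sol k) r.slater).1
  have h' := congrArg norm h
  rw [norm_smul, norm_norm] at h'
  rw [normal, norm_neg]
  exact mul_left_cancel₀ hk.ne' (by rw [← h', mul_one])

theorem target_subset_halfspace (k : ℕ) :
    r.target ⊆ halfspace (r.wsol (r.vertex k) - r.lsol (r.vertex k) • normalizedSum r.gen)
      (r.vertex k + r.zsol (r.vertex k)) :=
  ((r.dual_sol k _ (r.vertex_mem k)).supports (r.vertex_sol k) r.slater).2

theorem target_subset_outer (k : ℕ) : r.target ⊆ r.outer k := by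
  induction k with
  | zero =>
    rw [r.outer_zero]
    refine inter_subset_inter_left _ ?_
    rintro _ ⟨_, ⟨x, hx, rfl⟩, c, hc, rfl⟩
    refine mem_iInter.2 fun j => ?_
    have h1 := (r.xinit_sol j).2 x hx
    have h2 := p.mem_dualCone.1 (r.gen_mem_dualCone j) c hc
    rw [real_inner_comm] at h2
    simp only [halfspace, mem_ofPred_eq, inner_add_right]
    linarith
  | succ k ih => rw [r.outer_succ]; exact subset_inter ih (r.target_subset_halfspace k)

theorem infDist_le_and_hausdorffDist_le (hq : 1 ≤ q) (k : ℕ) :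
    (∀ x ∈ r.outer k, Metric.infDist x r.target ≤ ‖r.zsol (r.vertex k)‖) ∧
      Metric.hausdorffDist (r.outer k) r.target ≤ ‖r.zsol (r.vertex k)‖ := by
  refine hausdorffDist_le_of_extremePoints (norm_nonneg _) (r.isCompact_outer hq k)
    (r.convex_outer k) r.convex_target ⟨_, r.foot_mem 0⟩ (r.target_subset_outer k) fun v hv => ?_
  rw [target, (r.primal_sol k v hv).infDist_eq]
  exact r.vertex_max k v hv

/-- Depths decrease because the outer sets do and `d k` bounds the distance to the target on all of
`outer k`. A vertex chosen at step `j > i` has survived the cut of step `i`, which gives `cut`; the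
cut at `j` supports the target, which contains `foot i`, and this gives `proj`. -/
theorem isCutSequence (hq : 1 ≤ q) :
    IsCutSequence r.foot r.normal fun k => ‖r.zsol (r.vertex k)‖ where
  nonneg k := norm_nonneg _
  anti := antitone_nat_of_succ_le fun k => by
    rw [← (r.vertex_sol (k + 1)).infDist_eq]
    exact (r.infDist_le_and_hausdorffDist_le hq k).1 _
      (r.outer_antitone k.le_succ (extremePoints_subset (r.vertex_mem (k + 1))))
  norm_eq k hk := r.norm_normal hk
  cut i j hij _ := by
    have h : r.vertex j ∈ r.outer (i + 1) :=
      r.outer_antitone hij (extremePoints_subset (r.vertex_mem j))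
    rw [r.outer_succ] at h
    have := h.2
    simp only [halfspace, mem_ofPred_eq] at this
    rw [foot_add_smul_normal, normal, foot, inner_neg_left, inner_sub_right]
    linarith
  proj i j _ := by
    have := r.target_subset_halfspace j (r.foot_mem i)
    simp only [halfspace, mem_ofPred_eq] at this
    rw [normal, inner_neg_left, inner_sub_right]
    unfold foot at this ⊢
    linarith

end Run

end OuterApprox

theorem mainTheorem1 {n q : ℕ} (hq : 2 ≤ q) (p : OuterApprox.CVOP n q)
    (hC : OuterApprox.IsPolyhedral (p.cone : Set (OuterApprox.Euc q)))
    (r : OuterApprox.Run p) (ε : ℝ) (hε : ε ∈ Set.Ioo (0 : ℝ) 1) :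
    ∃ N : ℕ, 1 ≤ N ∧ ∀ k : ℕ, N ≤ k →
      Metric.hausdorffDist (r.outer (k - 1)) r.target
        ≤ (1 + ε) * OuterApprox.lambdaBar r.target * (k : ℝ) ^ ((2 : ℝ) / (1 - (q : ℝ))) := by
  have hq1 : 1 ≤ q := by omega
  have hcut := r.isCutSequence hq1
  have hbd : Bornology.IsBounded r.target :=
    (r.isBounded_outer_zero hq1).subset (r.target_subset_outer 0)
  have hR := OuterApprox.circumscribedRadius_pos hbd (r.target_nontrivial hq1)
  have hlim := hcut.tendsto_zero (r.isBounded_outer_zero hq1) fun k => by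
    rw [r.foot_add_smul_normal]
    exact r.outer_antitone (Nat.zero_le k) (extremePoints_subset (r.vertex_mem k))
  obtain ⟨N, hN, h⟩ := hcut.exists_rate hq hR hlim (fun R' hR' => by
    obtain ⟨c, hc⟩ := OuterApprox.exists_subset_closedBall_of_circumscribedRadius_lt hbd hR'
    exact ⟨c, fun k => Metric.mem_closedBall.1 (hc (r.foot_mem k))⟩) hε
  refine ⟨N, hN, fun k hk => ((r.infDist_le_and_hausdorffDist_le hq1 (k - 1)).2.trans
    (h k hk)).trans ?_⟩
  -- The factor 2 lost in comparing the packing constants turns `8 R` into the `16 R` of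
  -- `lambdaBar`.
  have hle := mul_le_mul_of_nonneg_left (OuterApprox.two_mul_rpow_le q hq)
    (show 0 ≤ 8 * OuterApprox.circumscribedRadius r.target by positivity)
  have hε0 := hε.1
  apply mul_le_mul_of_nonneg_right _ (by positivity)
  apply mul_le_mul_of_nonneg_left _ (by positivity)
  unfold OuterApprox.lambdaBar
  linarith
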